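/- Let $\mathcal X,\mathcal Y$ be finite nonempty alphabets. A POST channel is a finite state channel whose state is the previous output: it is given by probability distributions $p(\cdot\mid x,s)$ on $\mathcal Y$ ($x\in\mathcal X$, $s\in\mathcal Y$), and, when used without feedback from the initial state $s_0=y_0\in\mathcal Y$, $$p(y^n\mid x^n,s_0)=\prod_{i=1}^n p(y_i\mid x_i,y_{i-1}).$$ For a distribution $P(x^n)$ on $\mathcal X^n$ let $I(X^n;Y^n\mid s_0)$ be the mutual information, in bits, of the pair with joint law $P(x^n)\,p(y^n\mid x^n,s_0)$. Let $\emptyset\ne A\subseteq\mathcal Y$ be the set of possible initial states, and let the encoder and the decoder know, respectively, $u(s_0)$ and $v(s_0)$, where $u,v$ are arbitrary functions on $\mathcal Y$ (constant if the initial state is unknown, the identity if it is known). A rate $R\in\mathbb R$ is achievable without feedback if for every $\varepsilon>0$ and all sufficiently large $N$ there is a block code of length $N$ with at least $2^{NR}$ messages (the codeword depends only on the message and $u(s_0)$, the decision only on $y^N$ and $v(s_0)$) whose error probability, averaged over the messages, is at most $\varepsilon$ for every initial state $s_0\in A$. The non-feedback capacity $C$ is the supremum of the achievable rates. Then for every POST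 channel, every such $A,u,v$ and every integer $n\ge1$, the maximum of $I(X^n;Y^n\mid s_0)$ over $s_0\in\mathcal Y$ and $P(x^n)$ is attained, and $$C\le\frac1n\,\max_{s_0}\max_{P(x^n)} I(X^n;Y^n\mid s_0).$$ -/

import Mathlib

open scoped BigOperators

/-- A POST ("previous output is the state") channel with input alphabet `X` and output alphabet
`Y`: a finite state channel whose state is the previous output.
`trans s x y` is the probability of the output `y` when the previous output is `s` and the
current input is `x`. -/
structure POSTChannel (X Y : Type*) [Fintype Y] where
  trans : Y → X → Y → ℝ
  trans_mem : ∀ s x, trans s x ∈ stdSimplex ℝ Y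

namespace POSTChannel

variable {X Y : Type*} [Fintype X] [Fintype Y]

/-- The `n`-block law without feedback, `p(y^n | x^n, s₀) = ∏ i, p(y_i | x_i, y_{i-1})`, where
`y_0 = s₀` is the initial state. -/
def blockLaw (W : POSTChannel X Y) {n : ℕ} (s₀ : Y) (x : Fin n → X) (y : Fin n → Y) : ℝ :=
  ∏ i : Fin n, W.trans (Fin.cons (α := fun _ => Y) s₀ y i.castSucc) (x i) (y i)

end POSTChannel

/-- The mutual information (in bits) of a joint probability mass function `q` on `α × β`. Terms
with `q a b = 0` contribute `0`. -/
noncomputable def mutualInfo {α β : Type*} [Fintype α] [Fintype β] (q : α → β → ℝ) : ℝ :=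
  ∑ a, ∑ b, q a b * Real.logb 2 (q a b / ((∑ b', q a b') * (∑ a', q a' b)))

/-- A block code of length `n` with `M` messages and no feedback. The encoder has the side
information `u : U` and the decoder has the side information `v : V` (about the initial state). -/
structure BlockCode (X Y U V : Type*) (n M : ℕ) where
  enc : U → Fin M → (Fin n → X)
  dec : V → (Fin n → Y) → Fin M

namespace POSTChannel

variable {X Y U V : Type*} [Fintype X] [Fintype Y]

/-- `I(X^n; Y^n | s₀)` for the input law `P(x^n) = p`, which does not depend on the outputs. -/
noncomputable def blockInfo (W : POSTChannel X Y) {n : ℕ} (s₀ : Y) (p : (Fin n → X) → ℝ) : ℝ :=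
  mutualInfo fun (x : Fin n → X) (y : Fin n → Y) => p x * W.blockLaw s₀ x y

/-- All values of `I(X^n; Y^n | s₀)`, over the initial states `s₀` and the input laws `P(x^n)`. -/
def blockInfoValues (W : POSTChannel X Y) (n : ℕ) : Set ℝ :=
  {r | ∃ s₀ : Y, ∃ p ∈ stdSimplex ℝ (Fin n → X), r = W.blockInfo s₀ p}

/-- The error probability, for a uniformly distributed message, when the initial state is `s₀`,
the encoder knows `u s₀` and the decoder knows `v s₀`. -/
noncomputable def errorProb (W : POSTChannel X Y) (u : Y → U) (v : Y → V) {n M : ℕ}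
    (c : BlockCode X Y U V n M) (s₀ : Y) : ℝ :=
  (∑ m : Fin M, ∑ y : Fin n → Y,
    if c.dec (v s₀) y = m then 0 else W.blockLaw s₀ (c.enc (u s₀) m) y) / M

/-- The rate `R` (bits per channel use) is achievable without feedback: for all large `n` there
are codes of length `n` with at least `2 ^ (n R)` messages whose error probability tends to zero
for every initial state in `A`, the set of possible initial states. (Since `Y` is finite, for a
random initial state with law `π` this is vanishing average error probability when `A` is the
support of `π`; `A = univ` is the worst case over all initial states.) -/
def IsAchievable (W : POSTChannel X Y) (A : Set Y) (u : Y → U) (v : Y → V) (R : ℝ) : Prop :=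
  ∀ ε : ℝ, 0 < ε → ∃ N : ℕ, ∀ n : ℕ, N ≤ n → ∃ M : ℕ, 0 < M ∧ (2 : ℝ) ^ ((n : ℝ) * R) ≤ M ∧
    ∃ c : BlockCode X Y U V n M, ∀ s₀ ∈ A, W.errorProb u v c s₀ ≤ ε

/-- The non-feedback capacity: the supremum of the achievable rates. -/
noncomputable def capacity (W : POSTChannel X Y) (A : Set Y) (u : Y → U) (v : Y → V) : EReal :=
  sSup {C : EReal | ∃ R : ℝ, W.IsAchievable A u v R ∧ C = (R : EReal)}

end POSTChannel

/-!
Fix `n` and let `Imax` be the maximum of `I(X^n; Y^n | s₀)`. It is attained because mutual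
information is `H(X) + H(Y) - H(X, Y)`, hence continuous in the joint law, and the input laws form
a compact simplex (`POSTChannel.isCompact_blockInfoValues`).

The converse compares codes of length `k n` with `k` blocks of length `n`. Split a block of length
`m + n` after its first `m` symbols. By the chain rule (`mutualInfo_comp`),
`I(X^{m+n}; Y^{m+n} | s₀)` is `I(X^m; Y^m | s₀)` plus the average over `y^m` of the information
conveyed in the second part given `Y^m = y^m`. Conditionally on `y^m`, the second part is a use of
the same block channel, started from the *known* state `y_m`, with the input law
`P(x_{m+1}^{m+n} | y^m)`; so it conveys at most `Imax`. Here it matters that the state is the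
previous output, which is part of what is conditioned on. Hence `I(X^{kn}; Y^{kn} | s₀) ≤ k Imax`
for every input law and every initial state (`POSTChannel.blockInfo_mul_le`).

A Fano-type inequality (`one_sub_error_mul_log_le`) bounds `(1 - e) log M - 1` by the mutual
information (in nats) created by a code with `M` messages and error probability `e`. For a fixed
initial state in `A` the side information is a constant, so the inequality applies to the code.
With `M ≥ 2 ^ (k n R)` and `k → ∞`, then `e → 0`, this gives `n R ≤ Imax`.
-/

/-! ### Mutual information of an input law and a channel -/

section MutualInfo

variable {α β : Type*} [Fintype α] [Fintype β]

lemma mutualInfo_equiv {α' β' : Type*} [Fintype α'] [Fintype β'] (e : α' ≃ α) (f : β' ≃ β)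
    (q : α → β → ℝ) : mutualInfo (fun a b => q (e a) (f b)) = mutualInfo q := by
  unfold mutualInfo
  refine Fintype.sum_equiv e _ _ fun a => Fintype.sum_equiv f _ _ fun b => ?_
  rw [Equiv.sum_comp f (fun b => q (e a) b), Equiv.sum_comp e (fun a => q a (f b))]

/-- `I = H(A) + H(B) - H(A, B)`. -/
lemma mutualInfo_eq_entropy (q : α → β → ℝ) (hq : ∀ a b, 0 ≤ q a b) :
    mutualInfo q = ((∑ a, Real.negMulLog (∑ b, q a b)) + (∑ b, Real.negMulLog (∑ a, q a b))
      - ∑ a, ∑ b, Real.negMulLog (q a b)) / Real.log 2 := by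
  have key : ∀ a b, q a b * Real.logb 2 (q a b / ((∑ b', q a b') * (∑ a', q a' b))) =
      (q a b * Real.log (q a b) - q a b * Real.log (∑ b', q a b')
        - q a b * Real.log (∑ a', q a' b)) / Real.log 2 := by
    intro a b
    rcases (hq a b).eq_or_lt with h | h
    · simp [← h]
    · have h1 : 0 < ∑ b', q a b' :=
        h.trans_le (Finset.single_le_sum (f := fun b' => q a b') (fun b' _ => hq a b')
          (Finset.mem_univ b))
      have h2 : 0 < ∑ a', q a' b :=
        h.trans_le (Finset.single_le_sum (f := fun a' => q a' b) (fun a' _ => hq a' b)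
          (Finset.mem_univ a))
      rw [Real.logb, Real.log_div h.ne' (mul_pos h1 h2).ne', Real.log_mul h1.ne' h2.ne']
      ring
  unfold mutualInfo
  simp only [key, Real.negMulLog]
  simp only [← Finset.sum_div, Finset.sum_sub_distrib]
  congr 1
  rw [Finset.sum_comm (f := fun a b => q a b * Real.log (∑ a', q a' b))]
  simp only [← Finset.sum_mul, neg_mul, Finset.sum_neg_distrib]
  ring

/-- `I = ∑ p(a) D(w(· | a) ‖ q)` where `q` is the output law. -/
lemma mutualInfo_mul_channel (p : α → ℝ) (w : α → β → ℝ) (hw : ∀ a, ∑ b, w a b = 1) :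
    mutualInfo (fun a b => p a * w a b) =
      ∑ a, ∑ b, p a * w a b * Real.logb 2 (w a b / ∑ a', p a' * w a' b) := by
  unfold mutualInfo
  refine Finset.sum_congr rfl fun a _ => Finset.sum_congr rfl fun b _ => ?_
  rw [← Finset.mul_sum, hw, mul_one]
  by_cases h : p a = 0
  · simp [h]
  · rw [mul_div_mul_left _ _ h]

/-- The chain rule for two successive uses of a channel without feedback, the second of which has
as its state the output `b₁` of the first: the information is that of the first use, plus the
average over `b₁` of the information of the second use under the conditional input law. -/
lemma mutualInfo_comp {α₁ α₂ β₁ β₂ : Type*} [Fintype α₁] [Fintype α₂] [Fintype β₁] [Fintype β₂]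
    (p : α₁ × α₂ → ℝ) (w₁ : α₁ → β₁ → ℝ) (w₂ : β₁ → α₂ → β₂ → ℝ) (hp : ∀ a, 0 ≤ p a)
    (hw₁ : ∀ a b, 0 ≤ w₁ a b) (hw₂ : ∀ s a b, 0 ≤ w₂ s a b)
    (hs₁ : ∀ a, ∑ b, w₁ a b = 1) (hs₂ : ∀ s a, ∑ b, w₂ s a b = 1) :
    mutualInfo (fun (a : α₁ × α₂) (b : β₁ × β₂) => p a * (w₁ a.1 b.1 * w₂ b.1 a.2 b.2)) =
      mutualInfo (fun a₁ b₁ => (∑ a₂, p (a₁, a₂)) * w₁ a₁ b₁) +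
      ∑ b₁, (∑ a₁, (∑ a₂, p (a₁, a₂)) * w₁ a₁ b₁) *
        mutualInfo (fun a₂ b₂ => ((∑ a₁, p (a₁, a₂) * w₁ a₁ b₁) /
          ∑ a₁, (∑ a₂, p (a₁, a₂)) * w₁ a₁ b₁) * w₂ b₁ a₂ b₂) := by
  set q₁ : β₁ → ℝ := fun b₁ => ∑ a₁, (∑ a₂, p (a₁, a₂)) * w₁ a₁ b₁ with hq₁
  set r : β₁ → α₂ → ℝ := fun b₁ a₂ => ∑ a₁, p (a₁, a₂) * w₁ a₁ b₁ with hr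
  set q : β₁ → β₂ → ℝ := fun b₁ b₂ => ∑ a₂, r b₁ a₂ * w₂ b₁ a₂ b₂ with hq
  have hr0 : ∀ b a, 0 ≤ r b a := fun b a =>
    Finset.sum_nonneg fun a₁ _ => mul_nonneg (hp _) (hw₁ _ _)
  have hq₁r : ∀ b₁, q₁ b₁ = ∑ a₂, r b₁ a₂ := fun b₁ => by
    simp only [hq₁, hr, Finset.sum_mul]
    exact Finset.sum_comm
  have hw : ∀ a : α₁ × α₂, ∑ b : β₁ × β₂, w₁ a.1 b.1 * w₂ b.1 a.2 b.2 = 1 := fun a => by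
    simp only [Fintype.sum_prod_type, ← Finset.mul_sum, hs₂, mul_one, hs₁]
  have hqq : ∀ b₁ b₂, ∑ a : α₁ × α₂, p a * (w₁ a.1 b₁ * w₂ b₁ a.2 b₂) = q b₁ b₂ :=
    fun b₁ b₂ => by
      simp only [Fintype.sum_prod_type_right, hq, hr, Finset.sum_mul, mul_assoc]
  have term : ∀ a₁ a₂ b₁ b₂,
      p (a₁, a₂) * (w₁ a₁ b₁ * w₂ b₁ a₂ b₂) *
        Real.logb 2 (w₁ a₁ b₁ * w₂ b₁ a₂ b₂ / q b₁ b₂) =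
      p (a₁, a₂) * w₁ a₁ b₁ * Real.logb 2 (w₁ a₁ b₁ / q₁ b₁) * w₂ b₁ a₂ b₂ +
      p (a₁, a₂) * w₁ a₁ b₁ *
        (w₂ b₁ a₂ b₂ * Real.logb 2 (w₂ b₁ a₂ b₂ / (q b₁ b₂ / q₁ b₁))) := by
    intro a₁ a₂ b₁ b₂
    rcases (hp (a₁, a₂)).eq_or_lt with h | h
    · simp [← h]
    rcases (hw₁ a₁ b₁).eq_or_lt with h1 | h1
    · simp [← h1]
    rcases (hw₂ b₁ a₂ b₂).eq_or_lt with h2 | h2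
    · simp [← h2]
    have hrpos : 0 < r b₁ a₂ := (mul_pos h h1).trans_le
      (Finset.single_le_sum (f := fun a₁ => p (a₁, a₂) * w₁ a₁ b₁)
        (fun a _ => mul_nonneg (hp _) (hw₁ _ _)) (Finset.mem_univ a₁))
    have hq₁pos : 0 < q₁ b₁ := by
      rw [hq₁r]
      exact hrpos.trans_le (Finset.single_le_sum (fun a _ => hr0 b₁ a) (Finset.mem_univ a₂))
    have hqpos : 0 < q b₁ b₂ := (mul_pos hrpos h2).trans_le
      (Finset.single_le_sum (f := fun a₂ => r b₁ a₂ * w₂ b₁ a₂ b₂)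
        (fun a _ => mul_nonneg (hr0 _ _) (hw₂ _ _ _)) (Finset.mem_univ a₂))
    have : w₁ a₁ b₁ * w₂ b₁ a₂ b₂ / q b₁ b₂ =
        (w₁ a₁ b₁ / q₁ b₁) * (w₂ b₁ a₂ b₂ / (q b₁ b₂ / q₁ b₁)) := by
      field_simp
    rw [this, Real.logb_mul (by positivity) (by positivity)]
    ring
  have first : mutualInfo (fun a₁ b₁ => (∑ a₂, p (a₁, a₂)) * w₁ a₁ b₁) =
      ∑ a₁, ∑ a₂, ∑ b₁, ∑ b₂,
        p (a₁, a₂) * w₁ a₁ b₁ * Real.logb 2 (w₁ a₁ b₁ / q₁ b₁) * w₂ b₁ a₂ b₂ := by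
    rw [mutualInfo_mul_channel _ _ hs₁]
    simp only [← Finset.mul_sum, hs₂, mul_one]
    refine Finset.sum_congr rfl fun a₁ _ => ?_
    rw [Finset.sum_comm]
    simp only [Finset.sum_mul, hq₁]
  have second : ∀ b₁, q₁ b₁ *
        mutualInfo (fun a₂ b₂ => (r b₁ a₂ / q₁ b₁) * w₂ b₁ a₂ b₂) =
      ∑ a₂, ∑ b₂, r b₁ a₂ *
        (w₂ b₁ a₂ b₂ * Real.logb 2 (w₂ b₁ a₂ b₂ / (q b₁ b₂ / q₁ b₁))) := by
    intro b₁
    rw [mutualInfo_mul_channel _ _ (hs₂ b₁)]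
    have hdiv : ∀ b₂, ∑ a, r b₁ a / q₁ b₁ * w₂ b₁ a b₂ = q b₁ b₂ / q₁ b₁ := fun b₂ => by
      simp only [hq, Finset.sum_div, div_mul_eq_mul_div]
    simp only [hdiv, Finset.mul_sum]
    refine Finset.sum_congr rfl fun a₂ _ => Finset.sum_congr rfl fun b₂ _ => ?_
    by_cases h : q₁ b₁ = 0
    · -- an output of probability zero: the conditional law is junk, but both sides vanish
      have hz : r b₁ a₂ = 0 :=
        (Finset.sum_eq_zero_iff_of_nonneg (fun a _ => hr0 b₁ a)).1 ((hq₁r b₁).symm.trans h) a₂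
          (Finset.mem_univ _)
      simp [hz]
    · field_simp
  rw [mutualInfo_mul_channel p (fun (a : α₁ × α₂) (b : β₁ × β₂) => w₁ a.1 b.1 * w₂ b.1 a.2 b.2) hw,
    first, Finset.sum_congr rfl fun b₁ _ => second b₁]
  simp only [Fintype.sum_prod_type] at hqq ⊢
  simp only [hqq, term, Finset.sum_add_distrib]
  congr 1
  simp only [hr, Finset.sum_mul]
  rw [Finset.sum_congr rfl fun a₁ _ => Finset.sum_comm, Finset.sum_comm]
  refine Finset.sum_congr rfl fun b₁ _ => ?_
  rw [Finset.sum_comm]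
  refine Finset.sum_congr rfl fun a₂ _ => ?_
  rw [Finset.sum_comm]

end MutualInfo

/-! ### The converse for a single code -/

section Fano

variable {α β : Type*} [Fintype α] [Fintype β]

/-- The law of the codeword `enc m` of a uniformly distributed message `m`. -/
noncomputable def codewordLaw {M : ℕ} (enc : Fin M → α) (a : α) : ℝ :=
  open Classical in ∑ m, if enc m = a then (M : ℝ)⁻¹ else 0

lemma sum_codewordLaw_mul {M : ℕ} (enc : Fin M → α) (f : α → ℝ) :
    ∑ a, codewordLaw enc a * f a = (M : ℝ)⁻¹ * ∑ m, f (enc m) := by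
  classical
  simp only [codewordLaw, Finset.sum_mul, ite_mul, zero_mul]
  rw [Finset.sum_comm, Finset.mul_sum]
  simp

lemma codewordLaw_mem {M : ℕ} (hM : 0 < M) (enc : Fin M → α) :
    codewordLaw enc ∈ stdSimplex ℝ α := by
  refine ⟨fun a => ?_, ?_⟩
  · unfold codewordLaw
    exact Finset.sum_nonneg fun m _ => by split_ifs <;> positivity
  · have := sum_codewordLaw_mul enc (fun _ => (1 : ℝ))
    simp only [mul_one, Finset.sum_const, Finset.card_univ, Fintype.card_fin, nsmul_eq_mul] at this
    rw [this, inv_mul_cancel₀ (by positivity)]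

/-- Gibbs' inequality for a single term, with a free scaling parameter `c`. -/
lemma mul_log_div_ge {a b c : ℝ} (ha : 0 ≤ a) (hb : 0 ≤ b) (hc : 0 < c) (hab : b = 0 → a = 0) :
    a * Real.log c + a - c * b ≤ a * Real.log (a / b) := by
  rcases ha.eq_or_lt with h | h
  · simp only [← h]
    nlinarith [mul_nonneg hc.le hb]
  have hb' : 0 < b := hb.lt_of_ne fun h0 => h.ne' (hab h0.symm)
  have h1 := Real.one_sub_inv_le_log_of_pos (x := a / b / c) (by positivity)
  rw [Real.log_div (by positivity) hc.ne'] at h1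
  have h2 := mul_le_mul_of_nonneg_left h1 h.le
  have h3 : a * (1 - (a / b / c)⁻¹) = a - c * b := by
    field_simp
  linarith

/-- A form of Fano's inequality: for a code with `M` messages and average error probability `e`,
`(1 - e) log M - 1` is at most the mutual information, in nats, of codeword and output. -/
lemma one_sub_error_mul_log_le (w : α → β → ℝ) (hw : ∀ a b, 0 ≤ w a b)
    (hs : ∀ a, ∑ b, w a b = 1) {M : ℕ} (hM : 0 < M) (enc : Fin M → α) (dec : β → Fin M) :
    (1 - (∑ m, ∑ y, if dec y = m then 0 else w (enc m) y) / M) * Real.log M - 1 ≤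
      mutualInfo (fun a b => codewordLaw enc a * w a b) * Real.log 2 := by
  have hM' : (0 : ℝ) < M := by exact_mod_cast hM
  set q : β → ℝ := fun b => (M : ℝ)⁻¹ * ∑ m, w (enc m) b with hq
  have hq0 : ∀ b, 0 ≤ q b := fun b =>
    mul_nonneg (by positivity) (Finset.sum_nonneg fun m _ => hw _ _)
  have hq1 : ∑ b, q b = 1 := by
    rw [← Finset.mul_sum, Finset.sum_comm]
    simp [hs, hM'.ne']
  have hqw : ∀ m b, q b = 0 → w (enc m) b = 0 := fun m b h => by
    have h' := (mul_eq_zero.1 h).resolve_left (by positivity)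
    exact (Finset.sum_eq_zero_iff_of_nonneg (fun m _ => hw _ _)).1 h' m (Finset.mem_univ _)
  have hI : mutualInfo (fun a b => codewordLaw enc a * w a b) * Real.log 2 =
      (M : ℝ)⁻¹ * ∑ m, ∑ b, w (enc m) b * Real.log (w (enc m) b / q b) := by
    rw [mutualInfo_mul_channel _ _ hs]
    have h2 : Real.log 2 ≠ 0 := by positivity
    simp only [sum_codewordLaw_mul, mul_assoc, ← Finset.mul_sum]
    rw [Finset.sum_mul]
    simp only [mul_assoc, Finset.sum_mul, Real.logb, div_mul_cancel₀ _ h2, hq]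
  -- Gibbs' inequality with scaling `M` where the decision is correct, and `1` elsewhere
  have hterm : ∀ m b, (w (enc m) b - if dec b = m then 0 else w (enc m) b) * Real.log M +
      w (enc m) b - (if dec b = m then M * q b else 0) - q b ≤
        w (enc m) b * Real.log (w (enc m) b / q b) := by
    intro m b
    by_cases h : dec b = m
    · have := mul_log_div_ge (hw (enc m) b) (hq0 b) hM' (hqw m b)
      simp only [h, if_true]
      linarith [hq0 b]
    · have := mul_log_div_ge (hw (enc m) b) (hq0 b) one_pos (hqw m b)
      simp only [h, if_false]
      rw [Real.log_one] at this
      linarith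
  have hsum := Finset.sum_le_sum fun m (_ : m ∈ Finset.univ) =>
    Finset.sum_le_sum fun b (_ : b ∈ Finset.univ) => hterm m b
  simp only [Finset.sum_sub_distrib, Finset.sum_add_distrib, ← Finset.sum_mul, hs, hq1] at hsum
  rw [Finset.sum_comm (f := fun m b => if dec b = m then M * q b else 0)] at hsum
  simp only [Finset.sum_ite_eq, Finset.mem_univ, if_true, ← Finset.mul_sum, hq1, mul_one,
    Finset.sum_const, Finset.card_univ, Fintype.card_fin, nsmul_eq_mul] at hsum
  rw [hI]
  refine le_trans (le_of_eq ?_) (mul_le_mul_of_nonneg_left hsum (inv_nonneg.2 hM'.le))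
  field_simp
  ring

end Fano

/-! ### Block laws of a POST channel -/

namespace POSTChannel

variable {X Y : Type*} [Fintype Y]

lemma blockLaw_nonneg (W : POSTChannel X Y) {n : ℕ} (s₀ : Y) (x : Fin n → X) (y : Fin n → Y) :
    0 ≤ W.blockLaw s₀ x y :=
  Finset.prod_nonneg fun _ _ => (W.trans_mem _ _).1 _

lemma blockLaw_cons (W : POSTChannel X Y) {n : ℕ} (s₀ : Y) (x : Fin (n + 1) → X) (y₀ : Y)
    (y : Fin n → Y) :
    W.blockLaw s₀ x (Fin.cons (α := fun _ => Y) y₀ y) =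
      W.trans s₀ (x 0) y₀ * W.blockLaw y₀ (Fin.tail x) y := by
  unfold blockLaw
  rw [Fin.prod_univ_succ]
  rfl

lemma sum_blockLaw (W : POSTChannel X Y) {n : ℕ} (s₀ : Y) (x : Fin n → X) :
    ∑ y, W.blockLaw s₀ x y = 1 := by
  induction n generalizing s₀ with
  | zero => simp [blockLaw]
  | succ n ih =>
    rw [← Equiv.sum_comp (Fin.consEquiv fun _ => Y), Fintype.sum_prod_type]
    have : ∀ (y₀ : Y) (y : Fin n → Y), W.blockLaw s₀ x (Fin.consEquiv (fun _ => Y) (y₀, y)) =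
        W.trans s₀ (x 0) y₀ * W.blockLaw y₀ (Fin.tail x) y := fun y₀ y => W.blockLaw_cons s₀ x y₀ y
    simp only [this, ← Finset.mul_sum, ih, mul_one]
    exact (W.trans_mem _ _).2

/-- The second part of a block starts from the last state of the first part, which is `s₀` if the
first part is empty. -/
lemma blockLaw_append (W : POSTChannel X Y) {m n : ℕ} (s₀ : Y) (x₁ : Fin m → X) (x₂ : Fin n → X)
    (y₁ : Fin m → Y) (y₂ : Fin n → Y) :
    W.blockLaw s₀ (Fin.append x₁ x₂) (Fin.append y₁ y₂) =
      W.blockLaw s₀ x₁ y₁ *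
        W.blockLaw (Fin.cons (α := fun _ => Y) s₀ y₁ (Fin.last m)) x₂ y₂ := by
  have hl : ∀ i : Fin m, Fin.cons (α := fun _ => Y) s₀ (Fin.append y₁ y₂)
      (Fin.castAdd n i).castSucc = Fin.cons (α := fun _ => Y) s₀ y₁ i.castSucc := by
    rintro ⟨i, hi⟩
    cases i with
    | zero => rfl
    | succ i => exact Fin.append_left y₁ y₂ ⟨i, by omega⟩
  have hr : ∀ j : Fin n, Fin.cons (α := fun _ => Y) s₀ (Fin.append y₁ y₂)
      (Fin.natAdd m j).castSucc = Fin.cons (α := fun _ => Y)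
        (Fin.cons (α := fun _ => Y) s₀ y₁ (Fin.last m)) y₂ j.castSucc := by
    rintro ⟨j, hj⟩
    cases j with
    | zero =>
      cases m with
      | zero => rfl
      | succ m => exact Fin.append_left y₁ y₂ (Fin.last m)
    | succ j => exact Fin.append_right y₁ y₂ ⟨j, by omega⟩
  unfold blockLaw
  rw [Fin.prod_univ_add]
  simp only [hl, hr, Fin.append_left, Fin.append_right]

/-! ### Block information -/

variable [Fintype X] {U V : Type*}

lemma isCompact_blockInfoValues (W : POSTChannel X Y) (n : ℕ) :
    IsCompact (W.blockInfoValues n) := by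
  have : W.blockInfoValues n =
      ⋃ s₀ : Y, (fun p => W.blockInfo s₀ p) '' stdSimplex ℝ (Fin n → X) := by
    ext r
    simp [blockInfoValues, eq_comm]
  rw [this]
  refine isCompact_iUnion fun s₀ => (isCompact_stdSimplex ℝ _).image_of_continuousOn ?_
  refine ContinuousOn.congr (f := fun p : (Fin n → X) → ℝ =>
    ((∑ x, Real.negMulLog (∑ y, p x * W.blockLaw s₀ x y))
      + (∑ y, Real.negMulLog (∑ x, p x * W.blockLaw s₀ x y))
      - ∑ x, ∑ y, Real.negMulLog (p x * W.blockLaw s₀ x y)) / Real.log 2) ?_ ?_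
  · have := Real.continuous_negMulLog
    fun_prop
  · intro p hp
    exact mutualInfo_eq_entropy _ fun x y => mul_nonneg (hp.1 x) (W.blockLaw_nonneg _ _ _)

/-- If the information of every second part of a block is at most `I₂`, a block of length `m + n`
conveys at most `I₁ + I₂`. -/
lemma blockInfo_add_le (W : POSTChannel X Y) {m n : ℕ} {I₁ I₂ : ℝ}
    (h₁ : ∀ s₀, ∀ p ∈ stdSimplex ℝ (Fin m → X), W.blockInfo s₀ p ≤ I₁)
    (h₂ : ∀ s₀, ∀ p ∈ stdSimplex ℝ (Fin n → X), W.blockInfo s₀ p ≤ I₂)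
    (s₀ : Y) {p : (Fin (m + n) → X) → ℝ} (hp : p ∈ stdSimplex ℝ (Fin (m + n) → X)) :
    W.blockInfo s₀ p ≤ I₁ + I₂ := by
  set P : (Fin m → X) × (Fin n → X) → ℝ := fun a => p (Fin.append a.1 a.2) with hP
  have hP0 : ∀ a, 0 ≤ P a := fun a => hp.1 _
  have hP1 : ∑ a₁, ∑ a₂, P (a₁, a₂) = 1 := by
    rw [← Fintype.sum_prod_type]
    exact (Equiv.sum_comp (Fin.appendEquiv m n) p).trans hp.2
  have hI : W.blockInfo s₀ p = mutualInfo (fun (a : (Fin m → X) × (Fin n → X))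
      (b : (Fin m → Y) × (Fin n → Y)) => P a * (W.blockLaw s₀ a.1 b.1 *
        W.blockLaw (Fin.cons (α := fun _ => Y) s₀ b.1 (Fin.last m)) a.2 b.2)) := by
    unfold blockInfo
    rw [← mutualInfo_equiv (Fin.appendEquiv m n) (Fin.appendEquiv m n)]
    simp only [← blockLaw_append]
    rfl
  have hq1 : ∑ b₁, ∑ a₁, (∑ a₂, P (a₁, a₂)) * W.blockLaw s₀ a₁ b₁ = 1 := by
    rw [Finset.sum_comm]
    simp only [← Finset.mul_sum, sum_blockLaw, mul_one, hP1]
  rw [hI, mutualInfo_comp P (fun a₁ b₁ => W.blockLaw s₀ a₁ b₁)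
    (fun b₁ a₂ b₂ => W.blockLaw (Fin.cons (α := fun _ => Y) s₀ b₁ (Fin.last m)) a₂ b₂) hP0
    (fun _ _ => W.blockLaw_nonneg _ _ _) (fun _ _ _ => W.blockLaw_nonneg _ _ _)
    (fun _ => W.sum_blockLaw _ _) (fun _ _ => W.sum_blockLaw _ _)]
  refine add_le_add (h₁ s₀ _ ⟨fun a => Finset.sum_nonneg fun _ _ => hP0 _, hP1⟩) ?_
  rw [← one_mul I₂, ← hq1, Finset.sum_mul]
  refine Finset.sum_le_sum fun b₁ _ => ?_
  have hq0 : 0 ≤ ∑ a₁, (∑ a₂, P (a₁, a₂)) * W.blockLaw s₀ a₁ b₁ :=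
    Finset.sum_nonneg fun _ _ => mul_nonneg (Finset.sum_nonneg fun _ _ => hP0 _)
      (W.blockLaw_nonneg _ _ _)
  rcases hq0.eq_or_lt with h | h
  · rw [← h, zero_mul, zero_mul]
  refine mul_le_mul_of_nonneg_left (h₂ (Fin.cons (α := fun _ => Y) s₀ b₁ (Fin.last m)) _ ⟨?_, ?_⟩)
    hq0
  · exact fun a => div_nonneg (Finset.sum_nonneg fun _ _ =>
      mul_nonneg (hP0 _) (W.blockLaw_nonneg _ _ _)) hq0
  · rw [← Finset.sum_div, div_eq_one_iff_eq h.ne', Finset.sum_comm]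
    simp only [Finset.sum_mul]

lemma blockInfo_mul_le (W : POSTChannel X Y) {n : ℕ} {I : ℝ}
    (h : ∀ s₀, ∀ p ∈ stdSimplex ℝ (Fin n → X), W.blockInfo s₀ p ≤ I) (k : ℕ) :
    ∀ s₀, ∀ p ∈ stdSimplex ℝ (Fin (k * n) → X), W.blockInfo s₀ p ≤ k * I := by
  induction k with
  | zero =>
    rw [Nat.zero_mul]
    intro s₀ p hp
    have hp1 := hp.2
    simp only [Fintype.sum_unique] at hp1
    simp [blockInfo, mutualInfo, blockLaw, hp1]
  | succ k ih =>
    rw [Nat.succ_mul]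
    intro s₀ p hp
    have := W.blockInfo_add_le ih h s₀ hp
    push_cast
    linarith

/-! ### The capacity bound -/

/-- The codes of an achievable rate exist at all large lengths, so lengths divisible by `n` are
enough, and no block is left over. -/
lemma IsAchievable.mul_le (W : POSTChannel X Y) {A : Set Y} (hA : A.Nonempty) {u : Y → U}
    {v : Y → V} {R : ℝ} (hR : W.IsAchievable A u v R) {n : ℕ} (hn : 1 ≤ n) {I : ℝ}
    (h : ∀ s₀, ∀ p ∈ stdSimplex ℝ (Fin n → X), W.blockInfo s₀ p ≤ I) : n * R ≤ I := by
  obtain ⟨s₀, hs₀⟩ := hA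
  have hlog : 0 < Real.log 2 := Real.log_pos one_lt_two
  have key : ∀ ε : ℝ, 0 < ε → ε < 1 → (1 - ε) * (n * R) ≤ I := by
    intro ε hε hε1
    obtain ⟨N, hN⟩ := hR ε hε
    have bound : ∀ k : ℕ, N ≤ k → k * (((1 - ε) * (n * R) - I) * Real.log 2) ≤ 1 := by
      intro k hk
      obtain ⟨M, hM, hMR, c, hc⟩ := hN (k * n) (hk.trans (Nat.le_mul_of_pos_right k hn))
      have hM' : (1 : ℝ) ≤ M := by exact_mod_cast hM
      have hfano := one_sub_error_mul_log_le (W.blockLaw s₀) (W.blockLaw_nonneg s₀)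
        (W.sum_blockLaw s₀) hM (c.enc (u s₀)) (c.dec (v s₀))
      have hinfo := W.blockInfo_mul_le h k s₀ _ (codewordLaw_mem hM (c.enc (u s₀)))
      have herr := hc s₀ hs₀
      unfold errorProb at herr
      have hlogM : ((k * n : ℕ) : ℝ) * R * Real.log 2 ≤ Real.log M := by
        rw [← Real.log_rpow two_pos]
        exact Real.log_le_log (by positivity) hMR
      have h1 := mul_le_mul_of_nonneg_right (sub_le_sub_left herr 1) (Real.log_nonneg hM')
      have h2 := mul_le_mul_of_nonneg_left hlogM (sub_nonneg.2 hε1.le)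
      have h3 := mul_le_mul_of_nonneg_right hinfo hlog.le
      unfold blockInfo at h3
      push_cast at h2
      linarith
    by_contra! hlt
    have hpos : 0 < ((1 - ε) * (n * R) - I) * Real.log 2 := mul_pos (sub_pos.2 hlt) hlog
    obtain ⟨k, hk⟩ := exists_nat_gt (1 / (((1 - ε) * (n * R) - I) * Real.log 2))
    rw [div_lt_iff₀ hpos] at hk
    have h1 := bound (max N k) (le_max_left _ _)
    have h2 : (k : ℝ) ≤ (max N k : ℕ) := by exact_mod_cast le_max_right N k
    linarith [mul_le_mul_of_nonneg_right h2 hpos.le]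
  have hlim : Filter.Tendsto (fun ε : ℝ => (1 - ε) * (n * R)) (nhdsWithin 0 (Set.Ioi 0))
      (nhds (n * R)) := by
    have : Continuous fun ε : ℝ => (1 - ε) * (n * R) := by fun_prop
    simpa using (this.tendsto 0).mono_left nhdsWithin_le_nhds
  refine le_of_tendsto hlim ?_
  filter_upwards [Ioo_mem_nhdsGT (zero_lt_one' ℝ)] with ε hε using key ε hε.1 hε.2

end POSTChannel

theorem mainTheorem9 {X Y U V : Type*} [Fintype X] [Nonempty X] [Fintype Y]
    (W : POSTChannel X Y) (A : Set Y) (hA : A.Nonempty) (u : Y → U) (v : Y → V)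
    (n : ℕ) (hn : 1 ≤ n) :
    ∃ Imax : ℝ, IsGreatest (W.blockInfoValues n) Imax ∧
      W.capacity A u v ≤ ((1 / (n : ℝ) * Imax : ℝ) : EReal) := by
  classical
  have hne : (W.blockInfoValues n).Nonempty := by
    obtain ⟨s₀, -⟩ := hA
    obtain ⟨x⟩ := ‹Nonempty X›
    exact ⟨_, s₀, _, single_mem_stdSimplex ℝ (fun _ => x), rfl⟩
  obtain ⟨I, hI⟩ := (W.isCompact_blockInfoValues n).exists_isGreatest hne
  refine ⟨I, hI, sSup_le ?_⟩
  rintro _ ⟨R, hR, rfl⟩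
  have hn' : (0 : ℝ) < n := by exact_mod_cast hn
  have := hR.mul_le W hA hn fun s₀ p hp => hI.2 ⟨s₀, p, hp, rfl⟩
  rw [EReal.coe_le_coe_iff, one_div, le_inv_mul_iff₀ hn']
  exact this
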